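/- Let $\Omega\subset\mathbb{R}^d$ be open and bounded (for instance a polytopal domain with $d\in\{1,2,3\}$), and let $V:=H^1_0(\Omega)$ be the closure of $C_c^\infty(\Omega)$ in $H^1(\Omega)$, with the norms $\|v\|_\lambda:=(\lambda\|\nabla v\|_{L^2(\Omega)}^2+\|v\|_{L^2(\Omega)}^2)^{1/2}$, $\lambda>0$. Let $C_P>0$ be a constant with $\|v\|_{L^2(\Omega)}^2\le C_P\|\nabla v\|_{L^2(\Omega)}^2$ for all $v\in V$. **Nonlinearity.** Let $f:\Omega\times\mathbb{R}\to\mathbb{R}$ be measurable in the first variable and differentiable in the second, with $f(\cdot,0)\in L^2(\Omega)$, and let $\rho>0$ be such that the set $\Lambda_f(\rho):=\{\lambda>0:\sigma_f(\lambda)<\rho+\tfrac1\lambda\}$ is non-empty, where $\sigma_f(\lambda):=\operatorname{ess\,sup}_{x\in\Omega}\sup_{u\in\mathbb{R}}\left|\tfrac{\partial f}{\partial u}(x,u)+\tfrac1\lambda\right|$. Put $\mu_f:=(\sup\Lambda_f(\rho))^{-1}$ if $\sup\Lambda_f(\rho)<\infty$ and $\mu_f:=0$ otherwise, and $\kappa_f:=\max\{\mu_f+\tfrac{\rho}{2}-\tfrac{1}{2C_P},0\}$.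 Fix a step size $\Delta t\in\Lambda_f(\rho)$ with $\tfrac1{\Delta t}>\kappa_f$. **Energy and residuals.** For $u,v\in V$ and $y\in L^2(\Omega)$ let $$E(u):=\tfrac12\int_\Omega|\nabla u|^2\,dx-\int_\Omega\int_0^{u(x)}f(x,s)\,ds\,dx,\qquad \langle E'(u),v\rangle:=\int_\Omega\big(\nabla u\cdot\nabla v-f(x,u)v\big)\,dx,$$ $$B_{\Delta t}(u,v):=\int_\Omega(\Delta t\,\nabla u\cdot\nabla v+uv)\,dx,\qquad \ell_{\Delta t}(y;v):=\int_\Omega\big(y+\Delta t\,f(x,y)\big)v\,dx.$$ For a subspace $W\subseteq V$ let $\|E'(u)\|_{W'}:=\sup_{w\in W\setminus\{0\}}|\langle E'(u),w\rangle|/\|w\|_{\Delta t}$ (and $0$ if $W=\{0\}$). **Algorithm.** Let $V_0\subseteq V_1\subseteq V_2\subseteq\dots\subset V$ be finite-dimensional subspaces, $\alpha\in(0,1)$ and $u_0^0\in V_0$. For each $N\ge0$ let $u_N^{n+1}\in V_N$, $n\ge0$, be defined by $B_{\Delta t}(u_N^{n+1},v)=\ell_{\Delta t}(u_N^n;v)$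 for all $v\in V_N$. Let $R_N(u)\in V_N$ denote the discrete residual, $B_{\Delta t}(R_N(u),v)=\langle E'(u),v\rangle$ for all $v\in V_N$; let $n^\star(N)$ be the least $n\ge1$ with $\|R_N(u_N^n)\|_{\Delta t}\le\alpha\,(E(u_N^0)-E(u_N^n))$; and put $\mathfrak{u}_N:=u_N^{n^\star(N)}$, $u_{N+1}^0:=\mathfrak{u}_N$. **Theorem (Convergence of the adaptive ILG procedure).** Suppose, in addition to the above, that for every $N$ the sequence $\{E(u_N^n)\}_{n\ge0}$ is bounded from below, that there is a constant $q\in(0,1)$ such that for all $N\ge0$ $$\|E'(\mathfrak{u}_N)\|_{V'}-\|E'(\mathfrak{u}_N)\|_{V_{N+1}'}\le q\,\big(\|E'(\mathfrak{u}_N)\|_{V'}-\|E'(\mathfrak{u}_N)\|_{V_N'}\big),$$ and that $\{\mathfrak{u}_N\}_N$ is bounded in $V$. Then $\{\mathfrak{u}_N\}_N$ has a subsequence that converges weakly in $V$ and strongly in $L^2(\Omega)$ to some $u^\star\in V$ which is a weak solution of $\Delta u+f(x,u)=0$ in $\Omega$, $u=0$ on $\partial\Omega$, i.e. $\langle E'(u^\star),v\rangle=0$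 for all $v\in V$. If, moreover, $f$ is continuous on $\overline{\Omega}\times\mathbb{R}$, then a further subsequence converges strongly in $V$ to $u^\star$. -/

import Mathlib

open MeasureTheory Set Filter Topology
open scoped ContDiff ENNReal

noncomputable section

namespace ILG

/-- The Euclidean space `ℝ^d`. -/
abbrev Eu (d : ℕ) : Type := EuclideanSpace ℝ (Fin d)

variable {d : ℕ}

/-! ### The Sobolev space `H^1_0(Ω)` -/

/-- `φ ∈ C_c^∞(Ω)`. -/
structure IsTest (Ω : Set (Eu d)) (φ : Eu d → ℝ) : Prop where
  smooth : ContDiff ℝ ∞ φ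
  compact : HasCompactSupport φ
  support : tsupport φ ⊆ Ω

/-- `L²(Ω)`. -/
abbrev L2 (Ω : Set (Eu d)) : Type := Lp ℝ 2 (volume.restrict Ω)

/-- `L²(Ω; ℝ^d)`. -/
abbrev L2Vec (Ω : Set (Eu d)) : Type := Lp (Eu d) 2 (volume.restrict Ω)

/-- `g` is the weak gradient of `u` on `Ω`. -/
def IsWeakGrad (Ω : Set (Eu d)) (u : L2 Ω) (g : L2Vec Ω) : Prop :=
  ∀ φ : Eu d → ℝ, IsTest Ω φ → ∀ i : Fin d,
    ∫ x in Ω, u x * fderiv ℝ φ x (EuclideanSpace.single i 1) = - ∫ x in Ω, g x i * φ x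

/-- The Hilbert space `L²(Ω) × L²(Ω; ℝ^d)` with `‖(u, g)‖² = ‖u‖² + ‖g‖²`. A function `u ∈ H^1(Ω)`
is represented by the pair `(u, ∇u)` in it, so that the norm of the pair is the `H^1`-norm of
`u`. -/
abbrev L2Pair (Ω : Set (Eu d)) : Type := WithLp 2 (L2 Ω × L2Vec Ω)

/-- The space `C_c^∞(Ω)`, as the set of all pairs `(φ, ∇φ)`. -/
def testSpace (Ω : Set (Eu d)) : Submodule ℝ (L2Pair Ω) where
  carrier := {w | ∃ φ : Eu d → ℝ, IsTest Ω φ ∧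
    (w.fst : Eu d → ℝ) =ᵐ[volume.restrict Ω] φ ∧
    (w.snd : Eu d → Eu d) =ᵐ[volume.restrict Ω] gradient φ}
  zero_mem' := by
    refine ⟨fun _ => 0, ⟨contDiff_const, HasCompactSupport.zero, by simp [tsupport]⟩, ?_, ?_⟩
    · exact Lp.coeFn_zero _ _ _
    · have : gradient (fun _ : Eu d => (0 : ℝ)) = 0 := by
        funext x
        simp [gradient]
      rw [this]
      exact Lp.coeFn_zero _ _ _
  add_mem' := by
    rintro a b ⟨φ, hφ, h1, h2⟩ ⟨ψ, hψ, h3, h4⟩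
    refine ⟨φ + ψ, ⟨hφ.smooth.add hψ.smooth, hφ.compact.add hψ.compact,
      (tsupport_add φ ψ).trans (union_subset hφ.support hψ.support)⟩, ?_, ?_⟩
    · filter_upwards [h1, h3, Lp.coeFn_add a.fst b.fst] with x e1 e3 e
      exact e.trans (by simp [e1, e3])
    · filter_upwards [h2, h4, Lp.coeFn_add a.snd b.snd] with x e2 e4 e
      have hd1 : DifferentiableAt ℝ φ x := (hφ.smooth.differentiable (by simp)).differentiableAt
      have hd2 : DifferentiableAt ℝ ψ x := (hψ.smooth.differentiable (by simp)).differentiableAt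
      exact e.trans (by simp [e2, e4, gradient, fderiv_add hd1 hd2])
  smul_mem' := by
    rintro c a ⟨φ, hφ, h1, h2⟩
    refine ⟨c • φ, ⟨hφ.smooth.const_smul c, hφ.compact.smul_left (f := fun _ => c),
      (tsupport_smul_subset_right (fun _ => c) φ).trans hφ.support⟩, ?_, ?_⟩
    · filter_upwards [h1, Lp.coeFn_smul c a.fst] with x e1 e
      exact e.trans (by simp [e1])
    · filter_upwards [h2, Lp.coeFn_smul c a.snd] with x e2 e
      have hd1 : DifferentiableAt ℝ φ x := (hφ.smooth.differentiable (by simp)).differentiableAt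
      exact e.trans (by simp [e2, gradient, fderiv_const_smul hd1])

/-- `V = H^1_0(Ω)`: the closure of `C_c^∞(Ω)` in the `H^1`-norm, as the set of all pairs
`(u, ∇u)`. -/
def H10 (Ω : Set (Eu d)) : Submodule ℝ (L2Pair Ω) := (testSpace Ω).topologicalClosure

/-- The function `u ∈ L²(Ω)` underlying an element of `H^1_0(Ω)`. -/
def fn {Ω : Set (Eu d)} (u : H10 Ω) : L2 Ω := (u : L2Pair Ω).fst

/-- The weak gradient `∇u ∈ L²(Ω; ℝ^d)` of an element of `H^1_0(Ω)`. -/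
def grad {Ω : Set (Eu d)} (u : H10 Ω) : L2Vec Ω := (u : L2Pair Ω).snd

/-- The second component of an element of `H^1_0(Ω)` is indeed the weak gradient of the first. -/
theorem isWeakGrad_grad {Ω : Set (Eu d)} (u : H10 Ω) : IsWeakGrad Ω (fn u) (grad u) := by
  intro φ hφ i
  set e : Eu d := EuclideanSpace.single i 1 with he
  have hφ1 : Continuous φ := hφ.smooth.continuous
  have hφ2 : Continuous (fun x => fderiv ℝ φ x e) :=
    (hφ.smooth.continuous_fderiv (by simp)).clm_apply continuous_const
  have hφ3 : HasCompactSupport (fun x => fderiv ℝ φ x e) :=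
    hφ.compact.fderiv_apply (𝕜 := ℝ) e
  have m1 : MemLp (fun x => fderiv ℝ φ x e) 2 (volume.restrict Ω) :=
    (hφ2.memLp_of_hasCompactSupport hφ3 (μ := volume)).restrict Ω
  have m2 : MemLp (fun x => φ x • e) 2 (volume.restrict Ω) :=
    ((hφ1.smul continuous_const).memLp_of_hasCompactSupport
      (hφ.compact.smul_right (f' := fun _ => e)) (μ := volume)).restrict Ω
  have k1 : ∀ w : L2 Ω, ∫ x in Ω, w x * fderiv ℝ φ x e = inner ℝ (m1.toLp _) w := by
    intro w
    rw [L2.inner_def]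
    refine integral_congr_ae ?_
    filter_upwards [m1.coeFn_toLp] with x hx
    simp [hx]
  have k2 : ∀ g : L2Vec Ω, ∫ x in Ω, g x i * φ x = inner ℝ (m2.toLp _) g := by
    intro g
    rw [L2.inner_def]
    refine integral_congr_ae ?_
    filter_upwards [m2.coeFn_toLp] with x hx
    rw [hx, inner_smul_left, he, EuclideanSpace.inner_single_left]
    simp [mul_comm]
  have hcl : IsClosed {w : L2Pair Ω | inner ℝ (m1.toLp _) w.fst = - inner ℝ (m2.toLp _) w.snd} := by
    refine isClosed_eq ?_ ?_
    · exact continuous_const.inner (WithLp.prod_continuous_ofLp 2 _ _).fst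
    · exact (continuous_const.inner (WithLp.prod_continuous_ofLp 2 _ _).snd).neg
  rw [k1, k2]
  refine closure_minimal (s := (testSpace Ω : Set (L2Pair Ω))) ?_ hcl u.2
  rintro w ⟨ψ, hψ, h1, h2⟩
  have hψ1 : Continuous ψ := hψ.smooth.continuous
  have hψ2 : Continuous (fun x => fderiv ℝ ψ x e) :=
    (hψ.smooth.continuous_fderiv (by simp)).clm_apply continuous_const
  have hψ3 : HasCompactSupport (fun x => fderiv ℝ ψ x e) :=
    hψ.compact.fderiv_apply (𝕜 := ℝ) e
  have e1 : ∫ x in Ω, w.fst x * fderiv ℝ φ x e = ∫ x in Ω, ψ x * fderiv ℝ φ x e :=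
    integral_congr_ae (by filter_upwards [h1] with x hx; rw [hx])
  have e2 : ∫ x in Ω, w.snd x i * φ x = ∫ x in Ω, fderiv ℝ ψ x e * φ x := by
    refine integral_congr_ae ?_
    filter_upwards [h2] with x hx
    have : gradient ψ x i = fderiv ℝ ψ x e := by
      rw [← toDual_gradient, InnerProductSpace.toDual_apply_apply, he,
        EuclideanSpace.inner_single_right]
      simp
    rw [hx, this]
  have o1 : ∫ x in Ω, ψ x * fderiv ℝ φ x e = ∫ x, ψ x * fderiv ℝ φ x e := by
    refine setIntegral_eq_integral_of_forall_compl_eq_zero fun x hx => ?_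
    rw [image_eq_zero_of_notMem_tsupport (fun h => hx (hψ.support h)), zero_mul]
  have o2 : ∫ x in Ω, fderiv ℝ ψ x e * φ x = ∫ x, fderiv ℝ ψ x e * φ x := by
    refine setIntegral_eq_integral_of_forall_compl_eq_zero fun x hx => ?_
    rw [image_eq_zero_of_notMem_tsupport (fun h => hx (hφ.support h)), mul_zero]
  change inner ℝ (m1.toLp _) w.fst = - inner ℝ (m2.toLp _) w.snd
  rw [← k1, ← k2, e1, e2, o1, o2]
  exact integral_mul_fderiv_eq_neg_fderiv_mul_of_integrable
    ((hψ2.mul hφ1).integrable_of_hasCompactSupport hφ.compact.mul_left)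
    ((hψ1.mul hφ2).integrable_of_hasCompactSupport hφ3.mul_left)
    ((hψ1.mul hφ1).integrable_of_hasCompactSupport hφ.compact.mul_left)
    (fun x _ => hψ.smooth.differentiable (by simp) x)
    (fun x _ => hφ.smooth.differentiable (by simp) x)

/-! ### Norms, nonlinearity and energy -/

/-- The norm `(λ ‖∇v‖² + ‖v‖²)^{1/2}`. -/
def lamNorm {Ω : Set (Eu d)} (lam : ℝ) (v : H10 Ω) : ℝ :=
  Real.sqrt (lam * ‖grad v‖ ^ 2 + ‖fn v‖ ^ 2)

/-- `CP` is a constant in the Poincaré inequality on `H^1_0(Ω)`. -/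
def IsPoincareConst (Ω : Set (Eu d)) (CP : ℝ) : Prop :=
  0 < CP ∧ ∀ v : H10 Ω, ‖fn v‖ ^ 2 ≤ CP * ‖grad v‖ ^ 2

/-- `σ_f(λ) = ess sup_{x ∈ Ω} sup_u |∂_u f(x, u) + 1/λ|`, with values in `[0, ∞]`. -/
def sigma (Ω : Set (Eu d)) (f : Eu d → ℝ → ℝ) (lam : ℝ) : ℝ≥0∞ :=
  essSup (fun x => ⨆ u : ℝ, ENNReal.ofReal |deriv (f x) u + 1 / lam|) (volume.restrict Ω)

/-- `Λ_f(ρ) = {λ > 0 : σ_f(λ) < ρ + 1/λ}`. -/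
def Lam (Ω : Set (Eu d)) (f : Eu d → ℝ → ℝ) (ρ : ℝ) : Set ℝ :=
  {lam | 0 < lam ∧ sigma Ω f lam < ENNReal.ofReal (ρ + 1 / lam)}

/-- The structural assumptions on the nonlinearity, with the constant `ρ`. -/
structure NonlinearityAssumption (Ω : Set (Eu d)) (f : Eu d → ℝ → ℝ) (ρ : ℝ) : Prop where
  measurable : ∀ t : ℝ, AEMeasurable (fun x => f x t) (volume.restrict Ω)
  memLp_zero : MemLp (fun x => f x 0) 2 (volume.restrict Ω)
  differentiable : ∀ x ∈ Ω, Differentiable ℝ (f x)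
  rho_pos : 0 < ρ
  nonempty : (Lam Ω f ρ).Nonempty

open Classical in
/-- `μ_f = 1 / sup Λ_f(ρ)` if the supremum is finite, and `0` otherwise. -/
def muf (Ω : Set (Eu d)) (f : Eu d → ℝ → ℝ) (ρ : ℝ) : ℝ :=
  if BddAbove (Lam Ω f ρ) then (sSup (Lam Ω f ρ))⁻¹ else 0

/-- `κ_f = max {μ_f + ρ/2 - 1/(2 C_P), 0}`. -/
def kappaf (Ω : Set (Eu d)) (f : Eu d → ℝ → ℝ) (ρ CP : ℝ) : ℝ :=
  max (muf Ω f ρ + ρ / 2 - 1 / (2 * CP)) 0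

/-- The energy `E(u) = 1/2 ∫_Ω |∇u|² - ∫_Ω F(x, u(x))`, where `F(x, t) = ∫_0^t f(x, s) ds`. -/
def energy {Ω : Set (Eu d)} (f : Eu d → ℝ → ℝ) (u : H10 Ω) : ℝ :=
  1 / 2 * (∫ x in Ω, ‖grad u x‖ ^ 2) - ∫ x in Ω, ∫ s in (0 : ℝ)..(fn u x), f x s

/-- `⟨E'(u), v⟩ = ∫_Ω (∇u · ∇v - f(x, u) v)`. -/
def dEnergy {Ω : Set (Eu d)} (f : Eu d → ℝ → ℝ) (u v : H10 Ω) : ℝ :=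
  ∫ x in Ω, (inner ℝ (grad u x) (grad v x) - f x (fn u x) * fn v x)

/-- `u` is a weak solution of `Δu + f(x, u) = 0` in `Ω`, `u = 0` on `∂Ω`. -/
def IsWeakSolution {Ω : Set (Eu d)} (f : Eu d → ℝ → ℝ) (u : H10 Ω) : Prop :=
  ∀ v : H10 Ω, dEnergy f u v = 0

/-- `B_λ(u, v) = ∫_Ω (λ ∇u · ∇v + u v)`. -/
def bil {Ω : Set (Eu d)} (lam : ℝ) (u v : H10 Ω) : ℝ :=
  ∫ x in Ω, (lam * inner ℝ (grad u x) (grad v x) + fn u x * fn v x)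

/-- `ℓ_λ(y; v) = ∫_Ω (y + λ f(x, y)) v`. -/
def lin {Ω : Set (Eu d)} (f : Eu d → ℝ → ℝ) (lam : ℝ) (y : L2 Ω) (v : H10 Ω) : ℝ :=
  ∫ x in Ω, (y x + lam * f x (y x)) * fn v x

/-- The dual norm `‖E'(u)‖_{W'} = sup_{w ∈ W, w ≠ 0} |⟨E'(u), w⟩| / ‖w‖_λ` on a subspace `W` of
`H^1_0(Ω)` (it is `0` for `W = {0}`). -/
def dualNorm {Ω : Set (Eu d)} (f : Eu d → ℝ → ℝ) (lam : ℝ) (W : Submodule ℝ (H10 Ω))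
    (u : H10 Ω) : ℝ :=
  ⨆ w : {w : H10 Ω // w ∈ W ∧ w ≠ 0}, |dEnergy f u w| / lamNorm lam (w : H10 Ω)

/-- The discretisation part `‖E'(u)‖_{V'} - ‖E'(u)‖_{W'}` of the residual, `V = H^1_0(Ω)`. -/
def disPart {Ω : Set (Eu d)} (f : Eu d → ℝ → ℝ) (lam : ℝ) (W : Submodule ℝ (H10 Ω))
    (u : H10 Ω) : ℝ :=
  dualNorm f lam ⊤ u - dualNorm f lam W u

/-! ### The adaptive algorithm -/

/-- `R ∈ W` is the discrete residual of `u` on `W`: `B_λ(R, v) = ⟨E'(u), v⟩` for all `v ∈ W`. -/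
def IsResidual {Ω : Set (Eu d)} (f : Eu d → ℝ → ℝ) (lam : ℝ) (W : Submodule ℝ (H10 Ω))
    (u R : H10 Ω) : Prop :=
  R ∈ W ∧ ∀ v ∈ W, bil lam R v = dEnergy f u v

/-- `unew ∈ W` is obtained from `u` by one step of the linearised iteration on `W`. -/
def IsIterStep {Ω : Set (Eu d)} (f : Eu d → ℝ → ℝ) (dt : ℝ) (W : Submodule ℝ (H10 Ω))
    (u unew : H10 Ω) : Prop :=
  unew ∈ W ∧ ∀ v ∈ W, bil dt unew v = lin f dt (fn u) v

/-- The stopping criterion `‖R_N(u_N^n)‖ ≤ α (E(u_N^0) - E(u_N^n))`, for the iterates `u n = u_N^n`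
on the space `W = V_N`. -/
def StopCriterion {Ω : Set (Eu d)} (f : Eu d → ℝ → ℝ) (dt α : ℝ) (W : Submodule ℝ (H10 Ω))
    (u : ℕ → H10 Ω) (n : ℕ) : Prop :=
  ∃ R : H10 Ω, IsResidual f dt W (u n) R ∧ lamNorm dt R ≤ α * (energy f (u 0) - energy f (u n))

/-- A run of the adaptive iterative linearised Galerkin algorithm with parameter `α`, step size
`dt` and Galerkin spaces `V N`: `u N n` is the `n`-th iterate on `V N`, and `nstar N` is the number
of iteration steps done on `V N`. (Each `repeat … until` loop does at least one step. The iterates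
`u N n` with `n > nstar N` are not used by the algorithm.) -/
structure IsRun {Ω : Set (Eu d)} (f : Eu d → ℝ → ℝ) (dt α : ℝ) (V : ℕ → Submodule ℝ (H10 Ω))
    (u : ℕ → ℕ → H10 Ω) (nstar : ℕ → ℕ) : Prop where
  init : u 0 0 ∈ V 0
  step : ∀ N n, IsIterStep f dt (V N) (u N n) (u N (n + 1))
  least : ∀ N, IsLeast {n | 1 ≤ n ∧ StopCriterion f dt α (V N) (u N) n} (nstar N)
  restart : ∀ N, u (N + 1) 0 = u N (nstar N)

end ILG

end

/-! The stopping criterion bounds the discrete residual on level `N` by `α` times the energy lost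
there. Each level restarts from the last final iterate, so these losses telescope. The energy is
bounded below on the bounded set of final iterates, hence the losses tend to zero, and so does
`E'(𝔲_N)` as a functional on `V_N`.

Along a weakly convergent subsequence `w_j ⇀ y`, the Rellich theorem gives strong `L²` convergence.
Since `f` acts as a Lipschitz operator on `L²`, `E'(w_j) → E'(y)` pointwise. As the spaces are
nested, `E'(y)` vanishes on every `V_n`; as `y` is a weak limit of elements of these spaces, also
`⟨E'(y), y⟩ = 0`. With `⟨E'(w_j), w_j⟩ → 0` this yields `‖∇w_j‖ → ‖∇y‖`, and weak convergence
becomes strong in `H^1_0`.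

The union of the `V_n` need not be dense, so the contraction hypothesis has to reach the rest of
`V`: it implies `(1 - q) ‖E'(w_j)‖_{V'} ≤ ‖E'(w_j)‖_{W'}` with `W` the next Galerkin space. Because
`E'(y)` vanishes on `W`, the right side is at most a constant times `‖w_j - y‖`. Thus `E'(w_j) → 0`
in `V'`, and `E'(y) = 0`.

The Rellich theorem is proved by averaging over balls of radius `r`: averaging costs at most `r
‖∇u‖` in `L²`, and for fixed `r` the averages of a weakly null sequence tend to zero by dominated
convergence. -/

/-! ### Weak convergence in Hilbert spaces -/

/-- Bounded sequences in a separable Hilbert space have weakly convergent subsequences. -/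
theorem exists_subseq_weakly_tendsto {H : Type*} [NormedAddCommGroup H] [InnerProductSpace ℝ H]
    [CompleteSpace H] [TopologicalSpace.SeparableSpace H] {x : ℕ → H} {M : ℝ}
    (hx : ∀ n, ‖x n‖ ≤ M) :
    ∃ (φ : ℕ → ℕ) (y : H), StrictMono φ ∧
      ∀ ℓ : H →L[ℝ] ℝ, Tendsto (fun j => ℓ (x (φ j))) atTop (𝓝 (ℓ y)) := by
  -- The Riesz isometry moves the sequence into the dual, where the sequential Banach–Alaoglu
  -- theorem applies.
  obtain ⟨g, -, φ, hφ, hg⟩ := WeakDual.isSeqCompact_closedBall ℝ H 0 M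
    (x := fun n => StrongDual.toWeakDual (InnerProductSpace.toDual ℝ H (x n))) (by
      intro n
      simpa using hx n)
  refine ⟨φ, (InnerProductSpace.toDual ℝ H).symm (WeakDual.toStrongDual g), hφ, fun ℓ => ?_⟩
  obtain ⟨v, rfl⟩ := (InnerProductSpace.toDual ℝ H).surjective ℓ
  have h := ((WeakDual.eval_continuous (𝕜 := ℝ) v).tendsto g).comp hg
  have e1 : ∀ z : H, InnerProductSpace.toDual ℝ H v z = InnerProductSpace.toDual ℝ H z v := by
    intro z
    simp [real_inner_comm]
  rw [e1, LinearIsometryEquiv.apply_symm_apply]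
  simp only [e1]
  exact h

/-- A weakly convergent sequence whose norms converge to the norm of the limit converges. -/
theorem tendsto_of_inner_of_norm_sq {H : Type*} [NormedAddCommGroup H] [InnerProductSpace ℝ H]
    {x : ℕ → H} {y : H} (h : Tendsto (fun n => inner ℝ y (x n)) atTop (𝓝 (‖y‖ ^ 2)))
    (hn : Tendsto (fun n => ‖x n‖ ^ 2) atTop (𝓝 (‖y‖ ^ 2))) : Tendsto x atTop (𝓝 y) := by
  rw [tendsto_iff_norm_sub_tendsto_zero]
  have h2 : Tendsto (fun n => ‖x n - y‖ ^ 2) atTop (𝓝 0) := by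
    have := (hn.sub (h.const_mul 2)).add_const (‖y‖ ^ 2)
    convert this using 2 with n
    · rw [norm_sub_sq_real, real_inner_comm]
    · ring
  have h3 := (Real.continuous_sqrt.tendsto 0).comp h2
  simpa [Function.comp_def] using h3

/-! ### `L²` estimates for translates and ball averages -/

namespace ENNReal

/-- Jensen's inequality for the square, in the form of monotonicity of `L^p` norms on a probability
space. -/
theorem sq_lintegral_le {α : Type*} [MeasurableSpace α] {μ : Measure α} [IsProbabilityMeasure μ]
    {g : α → ℝ≥0∞} (hg : AEMeasurable g μ) : (∫⁻ x, g x ∂μ) ^ 2 ≤ ∫⁻ x, g x ^ 2 ∂μ := by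
  have h := eLpNorm_le_eLpNorm_of_exponent_le (μ := μ) (p := 1) (q := 2) (f := g) (by norm_num)
    hg.aestronglyMeasurable
  rw [eLpNorm_one_eq_lintegral_enorm, eLpNorm_eq_lintegral_rpow_enorm_toReal (by simp) (by simp)]
    at h
  calc (∫⁻ x, g x ∂μ) ^ 2 ≤ ((∫⁻ x, g x ^ 2 ∂μ) ^ ((1 : ℝ) / 2)) ^ 2 := by
        gcongr
        simpa using h
    _ = ∫⁻ x, g x ^ 2 ∂μ := by
        rw [← ENNReal.rpow_natCast, ← ENNReal.rpow_mul]
        simp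

theorem add_sq_le_two_mul (a b : ℝ≥0∞) : (a + b) ^ 2 ≤ 2 * a ^ 2 + 2 * b ^ 2 := by
  rcases eq_or_ne a ∞ with rfl | ha
  · simp
  rcases eq_or_ne b ∞ with rfl | hb
  · simp
  lift a to NNReal using ha
  lift b to NNReal using hb
  norm_cast
  have : ((a : ℝ) + b) ^ 2 ≤ 2 * a ^ 2 + 2 * b ^ 2 := by nlinarith [sq_nonneg ((a : ℝ) - b)]
  exact_mod_cast this

end ENNReal

theorem MeasureTheory.L2.enorm_sq_eq_lintegral {α E : Type*} [MeasurableSpace α] {μ : Measure α}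
    [NormedAddCommGroup E] (w : Lp E 2 μ) : ‖w‖ₑ ^ 2 = ∫⁻ x, ‖w x‖ₑ ^ 2 ∂μ := by
  rw [Lp.enorm_def, eLpNorm_eq_lintegral_rpow_enorm_toReal (by simp) (by simp),
    ← ENNReal.rpow_natCast, ← ENNReal.rpow_mul]
  simp

/-- Translating a `C¹` function by `z` changes it in `L²` by at most `‖z‖ ‖∇φ‖`. -/
theorem lintegral_enorm_translate_sub_sq_le {E : Type*} [NormedAddCommGroup E] [NormedSpace ℝ E]
    [FiniteDimensional ℝ E] [MeasurableSpace E] [BorelSpace E] {μ : Measure E}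
    [μ.IsAddHaarMeasure] {φ : E → ℝ} (hφ : ContDiff ℝ 1 φ) (z : E) :
    ∫⁻ x, ‖φ (x + z) - φ x‖ₑ ^ 2 ∂μ ≤ ‖z‖ₑ ^ 2 * ∫⁻ x, ‖fderiv ℝ φ x‖ₑ ^ 2 ∂μ := by
  have hc : Continuous fun x => ‖fderiv ℝ φ x‖ₑ ^ 2 :=
    (ENNReal.continuous_pow 2).comp (hφ.continuous_fderiv (by simp)).enorm
  -- Fundamental theorem of calculus along the segment from `x` to `x + z`, then Jensen on `[0, 1]`.
  have key : ∀ x, ‖φ (x + z) - φ x‖ₑ ^ 2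
      ≤ ∫⁻ t in Icc (0 : ℝ) 1, ‖z‖ₑ ^ 2 * ‖fderiv ℝ φ (x + t • z)‖ₑ ^ 2 := by
    intro x
    have hd : ∀ t : ℝ, HasDerivAt (fun t : ℝ => φ (x + t • z)) (fderiv ℝ φ (x + t • z) z) t := by
      intro t
      have h1 : HasDerivAt (fun t : ℝ => x + t • z) z t := by
        simpa using ((hasDerivAt_id t).smul_const z).const_add x
      exact ((hφ.differentiable (by simp)) (x + t • z)).hasFDerivAt.comp_hasDerivAt t h1
    have hs : ContDiff ℝ 1 (fun t : ℝ => φ (x + t • z)) := by fun_prop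
    have h := enorm_sub_le_lintegral_deriv_of_contDiffOn_Icc (a := 0) (b := 1) hs.contDiffOn
      zero_le_one
    have : IsProbabilityMeasure (volume.restrict (Icc (0 : ℝ) 1)) := ⟨by simp⟩
    calc ‖φ (x + z) - φ x‖ₑ ^ 2
        ≤ (∫⁻ t in Icc (0 : ℝ) 1, ‖deriv (fun t : ℝ => φ (x + t • z)) t‖ₑ) ^ 2 := by
          gcongr
          simpa using h
      _ ≤ ∫⁻ t in Icc (0 : ℝ) 1, ‖deriv (fun t : ℝ => φ (x + t • z)) t‖ₑ ^ 2 :=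
          ENNReal.sq_lintegral_le (measurable_deriv _).enorm.aemeasurable
      _ ≤ _ := by
          refine lintegral_mono fun t => ?_
          rw [(hd t).deriv, ← mul_pow, mul_comm]
          gcongr
          exact ContinuousLinearMap.le_opENorm _ _
  calc ∫⁻ x, ‖φ (x + z) - φ x‖ₑ ^ 2 ∂μ
      ≤ ∫⁻ x, ∫⁻ t in Icc (0 : ℝ) 1, ‖z‖ₑ ^ 2 * ‖fderiv ℝ φ (x + t • z)‖ₑ ^ 2 ∂volume ∂μ :=
        lintegral_mono key
    _ = ∫⁻ t in Icc (0 : ℝ) 1, ∫⁻ x, ‖z‖ₑ ^ 2 * ‖fderiv ℝ φ (x + t • z)‖ₑ ^ 2 ∂μ ∂volume := by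
        refine lintegral_lintegral_swap ?_
        refine Measurable.aemeasurable ?_
        refine Measurable.const_mul ?_ _
        exact (hc.comp (continuous_fst.add (continuous_snd.smul continuous_const))).measurable
    _ = ∫⁻ t in Icc (0 : ℝ) 1, ‖z‖ₑ ^ 2 * ∫⁻ x, ‖fderiv ℝ φ x‖ₑ ^ 2 ∂μ := by
        refine lintegral_congr fun t => ?_
        rw [lintegral_const_mul' _ _ (by simp), lintegral_add_right_eq_self
          (fun x => ‖fderiv ℝ φ x‖ₑ ^ 2)]
    _ = _ := by simp

/-- Replacing a `C¹` function by its averages over balls of radius `r` changes it in `L²` by at most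
`r ‖∇φ‖`. -/
theorem lintegral_enorm_sub_average_sq_le {E : Type*} [NormedAddCommGroup E] [NormedSpace ℝ E]
    [FiniteDimensional ℝ E] [MeasurableSpace E] [BorelSpace E] {μ : Measure E}
    [μ.IsAddHaarMeasure] {φ : E → ℝ} (hφ : ContDiff ℝ 1 φ) {r : ℝ} (hr : 0 < r) :
    ∫⁻ x, ‖φ x - ⨍ y in Metric.ball x r, φ y ∂μ‖ₑ ^ 2 ∂μ
      ≤ ENNReal.ofReal r ^ 2 * ∫⁻ x, ‖fderiv ℝ φ x‖ₑ ^ 2 ∂μ := by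
  set B := Metric.ball (0 : E) r
  have hB0 : μ B ≠ 0 := (Metric.measure_ball_pos μ 0 hr).ne'
  have hBt : μ B ≠ (⊤ : ℝ≥0∞) := measure_ball_lt_top.ne
  -- A single probability measure on the centred ball represents the averages around all points `x`,
  -- so that Tonelli applies.
  set ν : Measure E := (μ B)⁻¹ • μ.restrict B with hν
  have hprob : IsProbabilityMeasure ν := ⟨by
    simp [hν, ENNReal.inv_mul_cancel hB0 hBt]⟩
  have havg : ∀ x, ⨍ y in Metric.ball x r, φ y ∂μ = ∫ z, φ (x + z) ∂ν := by
    intro x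
    have e1 : μ (Metric.ball x r) = μ B := Measure.addHaar_ball_center μ x r
    have e2 : MeasurePreserving (fun z => x + z) (μ.restrict B) (μ.restrict (Metric.ball x r)) := by
      have := (measurePreserving_add_left μ x).restrict_preimage
        (s := Metric.ball x r) measurableSet_ball
      simpa [B, preimage_add_ball] using this
    rw [setAverage_eq, hν, integral_smul_measure, measureReal_def, e1, ENNReal.toReal_inv,
      ← e2.integral_comp (measurableEmbedding_addLeft x)]
  have hint : ∀ x, Integrable (fun z => φ (x + z)) ν := by
    intro x
    refine Integrable.smul_measure ?_ (by simpa using hB0)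
    exact ((hφ.continuous.comp (continuous_const.add continuous_id)).locallyIntegrable
      |>.integrableOn_isCompact (isCompact_closedBall 0 r)).mono_set Metric.ball_subset_closedBall
  have key : ∀ x, ‖φ x - ⨍ y in Metric.ball x r, φ y ∂μ‖ₑ ^ 2
      ≤ ∫⁻ z, ‖φ (x + z) - φ x‖ₑ ^ 2 ∂ν := by
    intro x
    have e : φ x - ⨍ y in Metric.ball x r, φ y ∂μ = - ∫ z, (φ (x + z) - φ x) ∂ν := by
      rw [integral_sub (hint x) (integrable_const _), havg]
      simp
    rw [e, enorm_neg]
    calc _ ≤ (∫⁻ z, ‖φ (x + z) - φ x‖ₑ ∂ν) ^ 2 := by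
          gcongr
          exact enorm_integral_le_lintegral_enorm _
      _ ≤ _ := ENNReal.sq_lintegral_le (by
          have : Continuous φ := hφ.continuous
          fun_prop)
  calc _ ≤ ∫⁻ x, ∫⁻ z, ‖φ (x + z) - φ x‖ₑ ^ 2 ∂ν ∂μ := lintegral_mono key
    _ = ∫⁻ z, ∫⁻ x, ‖φ (x + z) - φ x‖ₑ ^ 2 ∂μ ∂ν := by
        refine lintegral_lintegral_swap ?_
        have : Continuous φ := hφ.continuous
        exact ((ENNReal.continuous_pow 2).comp (((this.comp (continuous_fst.add continuous_snd)).sub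
          (this.comp continuous_fst)).enorm)).measurable.aemeasurable
    _ ≤ ∫⁻ z, ENNReal.ofReal r ^ 2 * ∫⁻ x, ‖fderiv ℝ φ x‖ₑ ^ 2 ∂μ ∂ν := by
        refine lintegral_mono_ae ?_
        refine Measure.ae_smul_measure ?_ _
        filter_upwards [ae_restrict_mem measurableSet_ball] with z hz
        refine (lintegral_enorm_translate_sub_sq_le hφ z).trans ?_
        gcongr
        rw [← ofReal_norm]
        exact ENNReal.ofReal_le_ofReal (by simpa using (mem_ball_zero_iff.1 hz).le)
    _ = _ := by simp

/-! ### `H^1_0(Ω)` as a separable Hilbert space -/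

noncomputable section

namespace ILG

variable {d : ℕ} {Ω : Set (Eu d)}

instance : CompleteSpace (H10 Ω) := by
  unfold H10
  infer_instance

instance : SecondCountableTopology (L2Vec Ω) :=
  haveI : Fact ((2 : ℝ≥0∞) ≠ ⊤) := ⟨by simp⟩
  Lp.SecondCountableTopology

instance : SecondCountableTopology (L2 Ω) :=
  haveI : Fact ((2 : ℝ≥0∞) ≠ ⊤) := ⟨by simp⟩
  Lp.SecondCountableTopology

instance : SecondCountableTopology (L2Pair Ω) := WithLp.secondCountableTopology 2 _ _

/-- The embedding `H^1_0(Ω) → L²(Ω)`. -/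
def fnL (Ω : Set (Eu d)) : H10 Ω →L[ℝ] L2 Ω := (WithLp.fstL 2 ℝ _ _).comp (H10 Ω).subtypeL

/-- The gradient as an operator `H^1_0(Ω) → L²(Ω; ℝ^d)`. -/
def gradL (Ω : Set (Eu d)) : H10 Ω →L[ℝ] L2Vec Ω := (WithLp.sndL 2 ℝ _ _).comp (H10 Ω).subtypeL

theorem fnL_apply (u : H10 Ω) : fnL Ω u = fn u := rfl

theorem gradL_apply (u : H10 Ω) : gradL Ω u = grad u := rfl

theorem norm_sq_eq (u : H10 Ω) : ‖u‖ ^ 2 = ‖fn u‖ ^ 2 + ‖grad u‖ ^ 2 :=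
  WithLp.prod_norm_sq_eq_of_L2 (u : L2Pair Ω)

theorem norm_fn_le (u : H10 Ω) : ‖fn u‖ ≤ ‖u‖ :=
  pow_le_pow_iff_left₀ (norm_nonneg _) (norm_nonneg _) two_ne_zero |>.1
    (by rw [norm_sq_eq]; nlinarith [sq_nonneg ‖grad u‖])

theorem norm_grad_le (u : H10 Ω) : ‖grad u‖ ≤ ‖u‖ :=
  pow_le_pow_iff_left₀ (norm_nonneg _) (norm_nonneg _) two_ne_zero |>.1
    (by rw [norm_sq_eq]; nlinarith [sq_nonneg ‖fn u‖])

/-! ### The Rellich theorem -/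

/-- The indicator function of the ball of radius `r` around `x`, as an element of `L²(Ω)`. -/
def ballIndicator (Ω : Set (Eu d)) (r : ℝ) (x : Eu d) : L2 Ω :=
  indicatorConstLp 2 (μ := volume.restrict Ω) (s := Metric.ball x r) measurableSet_ball
    ((Measure.restrict_apply_le _ _).trans_lt measure_ball_lt_top).ne 1

theorem inner_ballIndicator (r : ℝ) (x : Eu d) (w : L2 Ω) :
    inner ℝ (ballIndicator Ω r x) w = ∫ y in Metric.ball x r, w y ∂(volume.restrict Ω) :=
  L2.inner_indicatorConstLp_one measurableSet_ball _ w

theorem norm_ballIndicator_le (r : ℝ) (x : Eu d) :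
    ‖ballIndicator Ω r x‖ ≤ volume.real (Metric.ball (0 : Eu d) r) ^ ((1 : ℝ) / 2) := by
  rw [ballIndicator, norm_indicatorConstLp (by simp) (by simp)]
  simp only [norm_one, one_mul, ENNReal.toReal_ofNat]
  gcongr
  rw [measureReal_def, measureReal_def, ← Measure.addHaar_ball_center volume x r]
  exact ENNReal.toReal_mono measure_ball_lt_top.ne (Measure.restrict_apply_le _ _)

theorem measurable_inner_ballIndicator (r : ℝ) (w : L2 Ω) :
    Measurable fun x => inner ℝ (ballIndicator Ω r x) w := by
  -- Written with a jointly measurable kernel, the inner product is a parameter integral, hence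
  -- measurable in `x`.
  have e : (fun x => inner ℝ (ballIndicator Ω r x) w)
      = fun x => ∫ y, {p : Eu d × Eu d | dist p.2 p.1 < r}.indicator (fun p => w p.2) (x, y)
        ∂(volume.restrict Ω) := by
    funext x
    rw [inner_ballIndicator, ← integral_indicator measurableSet_ball]
    rfl
  rw [e]
  refine (StronglyMeasurable.integral_prod_right (f := fun x y =>
    {p : Eu d × Eu d | dist p.2 p.1 < r}.indicator (fun p => w p.2) (x, y)) ?_).measurable
  refine StronglyMeasurable.indicator ((Lp.stronglyMeasurable w).comp_measurable measurable_snd) ?_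
  exact measurableSet_lt (measurable_snd.dist measurable_fst) measurable_const

/-- Weak convergence gives pointwise convergence of the ball integrals; a constant dominates them,
and is integrable because `Ω` is bounded. -/
theorem tendsto_lintegral_inner_ballIndicator (hΩb : Bornology.IsBounded Ω) (r : ℝ) {w : ℕ → L2 Ω}
    {w₀ : L2 Ω} {M : ℝ} (hM : ∀ n, ‖w n‖ ≤ M)
    (hw : ∀ K : L2 Ω, Tendsto (fun n => inner ℝ K (w n)) atTop (𝓝 (inner ℝ K w₀))) :
    Tendsto (fun n => ∫⁻ x in Ω, ‖inner ℝ (ballIndicator Ω r x) (w n)‖ₑ ^ 2) atTop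
      (𝓝 (∫⁻ x in Ω, ‖inner ℝ (ballIndicator Ω r x) w₀‖ₑ ^ 2)) := by
  set C := volume.real (Metric.ball (0 : Eu d) r) ^ ((1 : ℝ) / 2)
  refine tendsto_lintegral_of_dominated_convergence (fun _ => ENNReal.ofReal (C * M) ^ 2)
    (fun n => (measurable_inner_ballIndicator r (w n)).enorm.pow_const 2) (fun n => ?_) ?_
    (Eventually.of_forall fun x => ?_)
  · refine Eventually.of_forall fun x => ?_
    simp only
    gcongr
    rw [← ofReal_norm]
    refine ENNReal.ofReal_le_ofReal ((norm_inner_le_norm _ _).trans ?_)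
    exact mul_le_mul (norm_ballIndicator_le r x) (hM n) (norm_nonneg _) (by positivity)
  · rw [lintegral_const]
    exact ENNReal.mul_ne_top (by finiteness) (by simpa using hΩb.measure_lt_top.ne)
  · exact (ENNReal.continuous_pow 2).tendsto _ |>.comp ((continuous_enorm.tendsto _).comp (hw _))

/-- Splits `φ` into its deviation from the ball average, controlled by `r ‖∇φ‖`, and the average
itself. Compact support in `Ω` makes extension by zero harmless, so no regularity of the boundary
enters. -/
theorem enorm_sq_fst_le_of_mem_testSpace {r : ℝ} (hr : 0 < r) {w : L2Pair Ω}
    (hw : w ∈ testSpace Ω) :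
    ‖w.fst‖ₑ ^ 2 ≤ 2 * (ENNReal.ofReal r ^ 2 * ‖w.snd‖ₑ ^ 2)
      + 2 * (‖(volume.real (Metric.ball (0 : Eu d) r))⁻¹‖ₑ ^ 2 *
        ∫⁻ x in Ω, ‖inner ℝ (ballIndicator Ω r x) w.fst‖ₑ ^ 2) := by
  obtain ⟨φ, hφ, h1, h2⟩ := hw
  have hφ1 : ContDiff ℝ 1 φ := hφ.smooth.of_le (by simp)
  have hg : ∫⁻ x, ‖fderiv ℝ φ x‖ₑ ^ 2 ≤ ‖w.snd‖ₑ ^ 2 := by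
    calc ∫⁻ x, ‖fderiv ℝ φ x‖ₑ ^ 2 = ∫⁻ x in tsupport φ, ‖fderiv ℝ φ x‖ₑ ^ 2 := by
          rw [← lintegral_indicator (isClosed_tsupport φ).measurableSet, indicator_eq_self.2]
          refine fun x hx => support_fderiv_subset ℝ fun h => hx ?_
          simp [← ofReal_norm, h]
      _ ≤ ∫⁻ x in Ω, ‖fderiv ℝ φ x‖ₑ ^ 2 := lintegral_mono_set hφ.support
      _ = ‖w.snd‖ₑ ^ 2 := by
          rw [L2.enorm_sq_eq_lintegral]
          refine lintegral_congr_ae ?_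
          filter_upwards [h2] with x hx
          rw [hx, gradient, ← ofReal_norm, ← ofReal_norm, LinearIsometryEquiv.norm_map]
  -- The ball may leave `Ω`, but `φ` vanishes there.
  have hA : ∀ x, ⨍ y in Metric.ball x r, φ y
      = (volume.real (Metric.ball (0 : Eu d) r))⁻¹ * inner ℝ (ballIndicator Ω r x) w.fst := by
    intro x
    rw [setAverage_eq, smul_eq_mul, inner_ballIndicator, measureReal_def, measureReal_def,
      Measure.addHaar_ball_center volume x r]
    congr 1
    rw [Measure.restrict_restrict measurableSet_ball]
    have e : ∫ y in Metric.ball x r ∩ Ω, w.fst y = ∫ y in Metric.ball x r ∩ Ω, φ y :=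
      integral_congr_ae (ae_restrict_of_ae_restrict_of_subset inter_subset_right h1)
    rw [e]
    refine setIntegral_eq_of_subset_of_forall_sdiff_eq_zero measurableSet_ball
      inter_subset_left fun y hy => ?_
    exact image_eq_zero_of_notMem_tsupport fun h => hy.2 ⟨hy.1, hφ.support h⟩
  calc ‖w.fst‖ₑ ^ 2 = ∫⁻ x in Ω, ‖φ x‖ₑ ^ 2 := by
        rw [L2.enorm_sq_eq_lintegral]
        refine lintegral_congr_ae ?_
        filter_upwards [h1] with x hx
        rw [hx]
    _ ≤ ∫⁻ x in Ω, (2 * ‖φ x - ⨍ y in Metric.ball x r, φ y‖ₑ ^ 2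
          + 2 * ‖⨍ y in Metric.ball x r, φ y‖ₑ ^ 2) := by
        refine lintegral_mono fun x => ?_
        refine le_trans ?_ (ENNReal.add_sq_le_two_mul _ _)
        gcongr
        calc ‖φ x‖ₑ = ‖(φ x - ⨍ y in Metric.ball x r, φ y) + ⨍ y in Metric.ball x r, φ y‖ₑ := by
              rw [sub_add_cancel]
          _ ≤ _ := enorm_add_le _ _
    _ = 2 * (∫⁻ x in Ω, ‖φ x - ⨍ y in Metric.ball x r, φ y‖ₑ ^ 2)
          + 2 * ∫⁻ x in Ω, ‖⨍ y in Metric.ball x r, φ y‖ₑ ^ 2 := by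
        rw [lintegral_add_right, lintegral_const_mul' _ _ (by simp),
          lintegral_const_mul' _ _ (by simp)]
        simp_rw [hA]
        exact (((measurable_inner_ballIndicator r w.fst).const_mul _).enorm.pow_const 2).const_mul _
    _ ≤ _ := by
        have e : ∫⁻ x in Ω, ‖⨍ y in Metric.ball x r, φ y‖ₑ ^ 2
            = ‖(volume.real (Metric.ball (0 : Eu d) r))⁻¹‖ₑ ^ 2 *
              ∫⁻ x in Ω, ‖inner ℝ (ballIndicator Ω r x) w.fst‖ₑ ^ 2 := by
          rw [← lintegral_const_mul' _ _ (by finiteness)]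
          simp_rw [hA, enorm_mul, mul_pow]
        rw [e]
        gcongr
        refine (setLIntegral_le_lintegral _ _).trans ?_
        refine (lintegral_enorm_sub_average_sq_le hφ1 hr).trans ?_
        gcongr

/-- For fixed `r` both sides pass to the limit along test functions converging in `H^1`. -/
theorem enorm_sq_fn_le (hΩb : Bornology.IsBounded Ω) {r : ℝ} (hr : 0 < r) (u : H10 Ω) :
    ‖fn u‖ₑ ^ 2 ≤ 2 * (ENNReal.ofReal r ^ 2 * ‖grad u‖ₑ ^ 2)
      + 2 * (‖(volume.real (Metric.ball (0 : Eu d) r))⁻¹‖ₑ ^ 2 *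
        ∫⁻ x in Ω, ‖inner ℝ (ballIndicator Ω r x) (fn u)‖ₑ ^ 2) := by
  obtain ⟨w, hw, hlim⟩ := mem_closure_iff_seq_limit.1
    (show (u : L2Pair Ω) ∈ closure (testSpace Ω : Set (L2Pair Ω)) from u.2)
  have h1 : Tendsto (fun n => (w n).fst) atTop (𝓝 (fn u)) :=
    ((WithLp.fstL 2 ℝ (L2 Ω) (L2Vec Ω)).continuous.tendsto _).comp hlim
  have h2 : Tendsto (fun n => (w n).snd) atTop (𝓝 (grad u)) :=
    ((WithLp.sndL 2 ℝ (L2 Ω) (L2Vec Ω)).continuous.tendsto _).comp hlim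
  obtain ⟨M, hM⟩ := h1.norm.bddAbove_range
  have h3 := tendsto_lintegral_inner_ballIndicator hΩb r (fun n => hM (mem_range_self n))
    fun K => tendsto_const_nhds.inner h1
  have sq : Continuous fun x : ℝ≥0∞ => x ^ 2 := ENNReal.continuous_pow 2
  refine le_of_tendsto_of_tendsto' ((sq.tendsto _).comp h1.enorm) (Tendsto.add
    (ENNReal.Tendsto.const_mul (ENNReal.Tendsto.const_mul ((sq.tendsto _).comp h2.enorm)
      (Or.inr (by finiteness))) (Or.inr (by simp)))
    (ENNReal.Tendsto.const_mul (ENNReal.Tendsto.const_mul h3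
      (Or.inr (by finiteness))) (Or.inr (by simp)))) fun n => ?_
  exact enorm_sq_fst_le_of_mem_testSpace hr (hw n)

/-- The **Rellich theorem**: on a bounded set, weak convergence in `H^1_0` implies strong
convergence in `L²`. -/
theorem tendsto_fn_of_weakly_tendsto (hΩb : Bornology.IsBounded Ω) {u : ℕ → H10 Ω} {u₀ : H10 Ω}
    {M : ℝ} (hM : ∀ n, ‖u n‖ ≤ M)
    (hu : ∀ ℓ : H10 Ω →L[ℝ] ℝ, Tendsto (fun n => ℓ (u n)) atTop (𝓝 (ℓ u₀))) :
    Tendsto (fun n => fn (u n)) atTop (𝓝 (fn u₀)) := by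
  -- The maximum with `1` keeps the denominator of `r` positive.
  set M' := max (M + ‖u₀‖) 1
  have hM' : ∀ n, ‖u n - u₀‖ ≤ M' := fun n =>
    (norm_sub_le _ _).trans ((add_le_add_left (hM n) _).trans (le_max_left _ _))
  have hM0 : 0 < M' := lt_of_lt_of_le one_pos (le_max_right _ _)
  have hsub : ∀ n, fn (u n - u₀) = fn (u n) - fn u₀ := fun n => map_sub (fnL Ω) _ _
  rw [tendsto_iff_norm_sub_tendsto_zero]
  have hw : ∀ K : L2 Ω, Tendsto (fun n => inner ℝ K (fn (u n - u₀))) atTop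
      (𝓝 (inner ℝ K (0 : L2 Ω))) := by
    intro K
    have := (hu ((innerSL ℝ K).comp (fnL Ω))).sub_const (((innerSL ℝ K).comp (fnL Ω)) u₀)
    simpa [hsub, inner_sub_right, fnL_apply] using this
  rw [Metric.tendsto_atTop]
  intro ε hε
  -- This radius makes the gradient term at most `2 r² M'² = ε² / 2`.
  set r := ε / (2 * M') with hr
  have hr0 : 0 < r := by positivity
  have h3 := tendsto_lintegral_inner_ballIndicator hΩb r
    (fun n => (norm_fn_le _).trans (hM' n)) hw
  have h4 : Tendsto (fun n => 2 * (‖(volume.real (Metric.ball (0 : Eu d) r))⁻¹‖ₑ ^ 2 *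
        ∫⁻ x in Ω, ‖inner ℝ (ballIndicator Ω r x) (fn (u n - u₀))‖ₑ ^ 2)) atTop (𝓝 0) := by
    have := ENNReal.Tendsto.const_mul (a := 2) (ENNReal.Tendsto.const_mul
      (a := ‖(volume.real (Metric.ball (0 : Eu d) r))⁻¹‖ₑ ^ 2) h3
      (Or.inr (by finiteness))) (Or.inr (by simp))
    simpa using this
  have h5 := h4.eventually_lt_const (u := ENNReal.ofReal (ε ^ 2 / 2)) (by simp; positivity)
  obtain ⟨n₀, hn₀⟩ := eventually_atTop.1 h5
  refine ⟨n₀, fun n hn => ?_⟩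
  have h6 : ENNReal.ofReal (‖fn (u n - u₀)‖ ^ 2) < ENNReal.ofReal (ε ^ 2) := by
    rw [ENNReal.ofReal_pow (norm_nonneg _), ofReal_norm]
    calc _ ≤ _ := enorm_sq_fn_le hΩb hr0 (u n - u₀)
      _ < ENNReal.ofReal (ε ^ 2 / 2) + ENNReal.ofReal (ε ^ 2 / 2) := by
          refine ENNReal.add_lt_add_of_le_of_lt ?_ ?_ (hn₀ n hn)
          · finiteness
          · rw [← ofReal_norm, ← ENNReal.ofReal_pow hr0.le, ← ENNReal.ofReal_pow (norm_nonneg _),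
              ← ENNReal.ofReal_mul (by positivity),
              two_mul, ← ENNReal.ofReal_add (by positivity) (by positivity), ← two_mul]
            refine ENNReal.ofReal_le_ofReal ?_
            have : ‖grad (u n - u₀)‖ ^ 2 ≤ M' ^ 2 := by
              gcongr
              exact (norm_grad_le _).trans (hM' n)
            calc 2 * (r ^ 2 * ‖grad (u n - u₀)‖ ^ 2) ≤ 2 * (r ^ 2 * M' ^ 2) := by gcongr
              _ = ε ^ 2 / 2 := by rw [hr]; field_simp
      _ = ENNReal.ofReal (ε ^ 2) := by
          rw [← ENNReal.ofReal_add (by positivity) (by positivity), add_halves]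
  have h7 := (ENNReal.ofReal_lt_ofReal_iff (by positivity)).1 h6
  rw [← hsub, Real.dist_eq, sub_zero, abs_of_nonneg (norm_nonneg _)]
  exact lt_of_pow_lt_pow_left₀ 2 hε.le h7

/-! ### The superposition operator -/

theorem exists_ae_lipschitzWith {f : Eu d → ℝ → ℝ} {ρ lam : ℝ} (hΩ : MeasurableSet Ω)
    (hf : NonlinearityAssumption Ω f ρ) (hlam : lam ∈ Lam Ω f ρ) :
    ∃ L : NNReal, ∀ᵐ x ∂(volume.restrict Ω), LipschitzWith L (f x) := by
  have hpos : 0 < 1 / lam := one_div_pos.2 hlam.1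
  have hρ := hf.rho_pos
  -- From `|∂_u f + 1/λ| ≤ ρ + 1/λ` it follows that `|∂_u f| ≤ ρ + 2/λ`.
  refine ⟨(ρ + 2 * (1 / lam)).toNNReal, ?_⟩
  filter_upwards [ENNReal.ae_le_essSup (μ := volume.restrict Ω)
    (fun x => ⨆ u : ℝ, ENNReal.ofReal |deriv (f x) u + 1 / lam|), ae_restrict_mem hΩ] with x hx hxΩ
  refine lipschitzWith_of_nnnorm_deriv_le (hf.differentiable x hxΩ) fun t => ?_
  have h1 : ENNReal.ofReal |deriv (f x) t + 1 / lam| ≤ ENNReal.ofReal (ρ + 1 / lam) :=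
    (le_iSup (fun u : ℝ => ENNReal.ofReal |deriv (f x) u + 1 / lam|) t).trans
      (hx.trans hlam.2.le)
  have h2 := (ENNReal.ofReal_le_ofReal_iff (by positivity)).1 h1
  rw [← NNReal.coe_le_coe, coe_nnnorm, Real.coe_toNNReal _ (by positivity), Real.norm_eq_abs]
  rw [abs_le] at h2 ⊢
  constructor <;> linarith

/-- Carathéodory's argument: for a simple function the composition is a finite sum of indicators,
and continuity in the second variable passes to the limit. -/
theorem aemeasurable_comp_of_ae_continuous {α : Type*} [MeasurableSpace α] {μ : Measure α}
    {f : α → ℝ → ℝ} (hm : ∀ t, AEMeasurable (fun x => f x t) μ) (hc : ∀ᵐ x ∂μ, Continuous (f x))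
    {u : α → ℝ} (hu : StronglyMeasurable u) : AEMeasurable (fun x => f x (u x)) μ := by
  refine aemeasurable_of_tendsto_metrizable_ae atTop (f := fun n x => f x (hu.approx n x))
    (fun n => ?_) ?_
  · have e : (fun x => f x (hu.approx n x))
        = fun x => ∑ c ∈ (hu.approx n).range, (hu.approx n ⁻¹' {c}).indicator (fun x => f x c) x := by
      funext x
      rw [Finset.sum_eq_single (hu.approx n x)]
      · simp
      · intro c _ hc
        exact indicator_of_notMem (fun h => hc (by simpa using h.symm)) _
      · intro h
        exact absurd (SimpleFunc.mem_range_self _ _) h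
    rw [e]
    exact Finset.aemeasurable_fun_sum _ fun c _ =>
      (hm c).indicator (SimpleFunc.measurableSet_fiber _ _)
  · filter_upwards [hc] with x hx
    exact (hx.tendsto _).comp (hu.tendsto_approx x)

/-- The Lipschitz bound gives `|f(x, u)| ≤ |f(x, 0)| + L |u|`, so the composition stays in `L²`. -/
theorem exists_superposition {f : Eu d → ℝ → ℝ} {ρ lam : ℝ} (hΩ : MeasurableSet Ω)
    (hf : NonlinearityAssumption Ω f ρ) (hlam : lam ∈ Lam Ω f ρ) :
    ∃ (N : L2 Ω → L2 Ω) (L : NNReal),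
      (∀ u : L2 Ω, N u =ᵐ[volume.restrict Ω] fun x => f x (u x)) ∧ LipschitzWith L N := by
  obtain ⟨L, hL⟩ := exists_ae_lipschitzWith hΩ hf hlam
  have hmem : ∀ u : L2 Ω, MemLp (fun x => f x (u x)) 2 (volume.restrict Ω) := by
    intro u
    have hmeas := aemeasurable_comp_of_ae_continuous hf.measurable
      (hL.mono fun x hx => hx.continuous) (Lp.stronglyMeasurable u)
    have h1 : MemLp (fun x => f x (u x) - f x 0) 2 (volume.restrict Ω) := by
      refine MemLp.of_le_mul (c := L) (Lp.memLp u)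
        (hmeas.sub (hf.measurable 0)).aestronglyMeasurable ?_
      filter_upwards [hL] with x hx
      simpa [dist_eq_norm] using hx.dist_le_mul (u x) 0
    convert h1.add hf.memLp_zero using 1
    funext x
    simp
  refine ⟨fun u => (hmem u).toLp _, L, fun u => (hmem u).coeFn_toLp, ?_⟩
  refine LipschitzWith.of_dist_le_mul fun u v => ?_
  rw [dist_eq_norm, dist_eq_norm]
  refine Lp.norm_le_mul_norm_of_ae_le_mul ?_
  filter_upwards [hL, (hmem u).coeFn_toLp, (hmem v).coeFn_toLp,
    Lp.coeFn_sub ((hmem u).toLp _) ((hmem v).toLp _), Lp.coeFn_sub u v] with x hx e1 e2 e3 e4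
  rw [e3, e4, Pi.sub_apply, Pi.sub_apply, e1, e2, ← dist_eq_norm, ← dist_eq_norm]
  exact hx.dist_le_mul _ _

/-! ### The energy and its derivative -/

/-- The energy is bounded from below on bounded sets. -/
theorem exists_le_energy {f : Eu d → ℝ → ℝ} {ρ lam : ℝ} (hΩ : MeasurableSet Ω)
    (hf : NonlinearityAssumption Ω f ρ) (hlam : lam ∈ Lam Ω f ρ) (M : ℝ) :
    ∃ C : ℝ, ∀ u : H10 Ω, ‖u‖ ≤ M → C ≤ energy f u := by
  obtain ⟨L, hL⟩ := exists_ae_lipschitzWith hΩ hf hlam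
  set I := ∫ x in Ω, (f x 0) ^ 2
  refine ⟨-(1 / 2 * I + (1 / 2 + L) * M ^ 2), fun u hu => ?_⟩
  have i1 : Integrable (fun x => (f x 0) ^ 2) (volume.restrict Ω) := hf.memLp_zero.integrable_sq
  have i2 : Integrable (fun x => (fn u x) ^ 2) (volume.restrict Ω) := (Lp.memLp _).integrable_sq
  have hn : ∫ x in Ω, (fn u x) ^ 2 = ‖fn u‖ ^ 2 := by
    rw [← real_inner_self_eq_norm_sq, L2.inner_def]
    simp
  have h1 : ‖∫ x in Ω, ∫ s in (0 : ℝ)..(fn u x), f x s‖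
      ≤ ∫ x in Ω, (1 / 2 * (f x 0) ^ 2 + (1 / 2 + L) * (fn u x) ^ 2) := by
    refine norm_integral_le_of_norm_le ((i1.const_mul _).add (i2.const_mul _)) ?_
    filter_upwards [hL] with x hx
    have h2 : ∀ s ∈ uIoc 0 (fn u x), ‖f x s‖ ≤ |f x 0| + L * |fn u x| := by
      intro s hs
      have h3 := hx.dist_le_mul s 0
      rw [Real.dist_eq, Real.dist_eq, sub_zero] at h3
      have h4 : |s| ≤ |fn u x| := by
        rcases le_total 0 (fn u x) with h | h
        · rw [uIoc_of_le h] at hs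
          rw [abs_of_pos hs.1, abs_of_nonneg h]
          exact hs.2
        · rw [uIoc_of_ge h] at hs
          rw [abs_of_nonpos hs.2, abs_of_nonpos h]
          linarith [hs.1]
      calc ‖f x s‖ = |f x 0 + (f x s - f x 0)| := by simp
        _ ≤ |f x 0| + |f x s - f x 0| := abs_add_le _ _
        _ ≤ |f x 0| + L * |fn u x| := by
            have : (L : ℝ) * |s| ≤ L * |fn u x| := by gcongr
            linarith
    have h5 := intervalIntegral.norm_integral_le_of_norm_le_const h2
    rw [sub_zero] at h5
    refine h5.trans ?_
    -- Young's inequality: `(|a| + L |t|) |t| ≤ a² / 2 + (1/2 + L) t²`.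
    nlinarith [sq_nonneg (|f x 0| - |fn u x|), sq_abs (f x 0), sq_abs (fn u x)]
  rw [integral_add (i1.const_mul _) (i2.const_mul _), integral_const_mul, integral_const_mul,
    hn] at h1
  have h6 : 0 ≤ ∫ x in Ω, ‖grad u x‖ ^ 2 := integral_nonneg fun x => by positivity
  have h7 : ‖fn u‖ ^ 2 ≤ M ^ 2 := by
    gcongr
    exact (norm_fn_le u).trans hu
  have h8 : (1 / 2 + (L : ℝ)) * ‖fn u‖ ^ 2 ≤ (1 / 2 + L) * M ^ 2 := by gcongr
  have h9 := (abs_le.1 (Real.norm_eq_abs _ ▸ h1)).2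
  rw [energy]
  linarith

theorem dEnergy_eq {f : Eu d → ℝ → ℝ} {N : L2 Ω → L2 Ω}
    (hN : ∀ u : L2 Ω, N u =ᵐ[volume.restrict Ω] fun x => f x (u x)) (u v : H10 Ω) :
    dEnergy f u v = inner ℝ (grad u) (grad v) - inner ℝ (N (fn u)) (fn v) := by
  rw [L2.inner_def, L2.inner_def, ← integral_sub (L2.integrable_inner _ _)
    (L2.integrable_inner _ _), dEnergy]
  refine integral_congr_ae ?_
  filter_upwards [hN (fn u)] with x hx
  rw [hx]
  simp [mul_comm]

theorem abs_dEnergy_le {f : Eu d → ℝ → ℝ} {N : L2 Ω → L2 Ω}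
    (hN : ∀ u : L2 Ω, N u =ᵐ[volume.restrict Ω] fun x => f x (u x)) (u v : H10 Ω) :
    |dEnergy f u v| ≤ (‖grad u‖ + ‖N (fn u)‖) * ‖v‖ := by
  rw [dEnergy_eq hN, add_mul]
  refine (abs_sub _ _).trans (add_le_add ?_ ?_)
  · exact (abs_real_inner_le_norm _ _).trans (by gcongr; exact norm_grad_le v)
  · exact (abs_real_inner_le_norm _ _).trans (by gcongr; exact norm_fn_le v)

theorem abs_dEnergy_sub_le {f : Eu d → ℝ → ℝ} {N : L2 Ω → L2 Ω} {L : NNReal}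
    (hN : ∀ u : L2 Ω, N u =ᵐ[volume.restrict Ω] fun x => f x (u x)) (hL : LipschitzWith L N)
    (u₁ u₂ v : H10 Ω) :
    |dEnergy f u₁ v - dEnergy f u₂ v| ≤ (1 + L) * ‖u₁ - u₂‖ * ‖v‖ := by
  have e1 : grad (u₁ - u₂) = grad u₁ - grad u₂ := map_sub (gradL Ω) _ _
  have e2 : fn (u₁ - u₂) = fn u₁ - fn u₂ := map_sub (fnL Ω) _ _
  have e : dEnergy f u₁ v - dEnergy f u₂ v
      = inner ℝ (grad (u₁ - u₂)) (grad v) - inner ℝ (N (fn u₁) - N (fn u₂)) (fn v) := by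
    rw [dEnergy_eq hN, dEnergy_eq hN, e1, inner_sub_left, inner_sub_left]
    ring
  have h1 : ‖N (fn u₁) - N (fn u₂)‖ ≤ L * ‖u₁ - u₂‖ := by
    have := hL.dist_le_mul (fn u₁) (fn u₂)
    rw [dist_eq_norm, dist_eq_norm, ← e2] at this
    exact this.trans (by gcongr; exact norm_fn_le _)
  rw [e, add_mul, add_mul, one_mul]
  refine (abs_sub _ _).trans (add_le_add ?_ ?_)
  · refine (abs_real_inner_le_norm _ _).trans ?_
    gcongr
    exacts [norm_grad_le _, norm_grad_le _]
  · refine (abs_real_inner_le_norm _ _).trans ?_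
    gcongr
    exact norm_fn_le _

/-- The derivative of the energy at `u` as a continuous linear functional. -/
theorem exists_clm_eq_dEnergy {f : Eu d → ℝ → ℝ} {N : L2 Ω → L2 Ω}
    (hN : ∀ u : L2 Ω, N u =ᵐ[volume.restrict Ω] fun x => f x (u x)) (u : H10 Ω) :
    ∃ ℓ : H10 Ω →L[ℝ] ℝ, ∀ v, ℓ v = dEnergy f u v :=
  ⟨(innerSL ℝ (grad u)).comp (gradL Ω) - (innerSL ℝ (N (fn u))).comp (fnL Ω), fun v => by
    simp [dEnergy_eq hN, gradL_apply, fnL_apply]⟩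

theorem exists_mul_norm_le_lamNorm {lam : ℝ} (hlam : 0 < lam) :
    ∃ c : ℝ, 0 < c ∧ ∀ v : H10 Ω, c * ‖v‖ ≤ lamNorm lam v := by
  refine ⟨Real.sqrt (min lam 1), Real.sqrt_pos.2 (lt_min hlam one_pos), fun v => ?_⟩
  refine Real.le_sqrt_of_sq_le ?_
  rw [mul_pow, Real.sq_sqrt (le_min hlam.le zero_le_one), norm_sq_eq]
  nlinarith [mul_le_mul_of_nonneg_right (min_le_left lam 1) (sq_nonneg ‖grad v‖),
    mul_le_mul_of_nonneg_right (min_le_right lam 1) (sq_nonneg ‖fn v‖)]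

theorem abs_bil_le {lam : ℝ} (hlam : 0 < lam) (u v : H10 Ω) :
    |bil lam u v| ≤ (lam + 1) * ‖u‖ * ‖v‖ := by
  have e : bil lam u v = lam * inner ℝ (grad u) (grad v) + inner ℝ (fn u) (fn v) := by
    rw [L2.inner_def, L2.inner_def, ← integral_const_mul, ← integral_add
      ((L2.integrable_inner _ _).const_mul _) (L2.integrable_inner _ _), bil]
    refine integral_congr_ae (Eventually.of_forall fun x => ?_)
    simp [mul_comm]
  rw [e, add_mul, add_mul, one_mul]
  refine (abs_add_le _ _).trans (add_le_add ?_ ?_)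
  · rw [abs_mul, abs_of_pos hlam, mul_assoc]
    gcongr
    refine (abs_real_inner_le_norm _ _).trans ?_
    gcongr
    exacts [norm_grad_le _, norm_grad_le _]
  · refine (abs_real_inner_le_norm _ _).trans ?_
    gcongr
    exacts [norm_fn_le _, norm_fn_le _]

/-! ### Dual norms -/

theorem dualNorm_nonneg (f : Eu d → ℝ → ℝ) (lam : ℝ) (W : Submodule ℝ (H10 Ω)) (u : H10 Ω) :
    0 ≤ dualNorm f lam W u :=
  Real.iSup_nonneg fun _ => div_nonneg (abs_nonneg _) (Real.sqrt_nonneg _)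

/-- The condition `0 ≤ C` covers `W = {0}`, where the supremum over the empty family is `0`. -/
theorem dualNorm_le {f : Eu d → ℝ → ℝ} {lam : ℝ} {W : Submodule ℝ (H10 Ω)} {u : H10 Ω} {C : ℝ}
    (hC : 0 ≤ C) (h : ∀ w ∈ W, |dEnergy f u w| ≤ C * lamNorm lam w) :
    dualNorm f lam W u ≤ C :=
  Real.iSup_le (fun w => div_le_of_le_mul₀ (Real.sqrt_nonneg _) hC (h w w.2.1)) hC

theorem abs_dEnergy_le_dualNorm {f : Eu d → ℝ → ℝ} {N : L2 Ω → L2 Ω}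
    (hN : ∀ u : L2 Ω, N u =ᵐ[volume.restrict Ω] fun x => f x (u x)) {lam : ℝ} (hlam : 0 < lam)
    (u v : H10 Ω) : |dEnergy f u v| ≤ dualNorm f lam ⊤ u * lamNorm lam v := by
  obtain ⟨c, hc, hcn⟩ := exists_mul_norm_le_lamNorm (Ω := Ω) hlam
  have hpos : ∀ w : H10 Ω, w ≠ 0 → 0 < lamNorm lam w := fun w hw =>
    lt_of_lt_of_le (mul_pos hc (norm_pos_iff.2 hw)) (hcn w)
  rcases eq_or_ne v 0 with rfl | hv
  · have h := abs_dEnergy_le hN u 0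
    rw [norm_zero, mul_zero] at h
    exact h.trans (mul_nonneg (dualNorm_nonneg _ _ _ _) (Real.sqrt_nonneg _))
  · rw [← div_le_iff₀ (hpos v hv)]
    refine le_ciSup (f := fun w : {w : H10 Ω // w ∈ (⊤ : Submodule ℝ (H10 Ω)) ∧ w ≠ 0} =>
      |dEnergy f u w| / lamNorm lam (w : H10 Ω)) ?_ ⟨v, Submodule.mem_top, hv⟩
    -- Boundedness of the quotients is needed, as a real supremum of an unbounded family is `0` by
    -- convention.
    refine ⟨(‖grad u‖ + ‖N (fn u)‖) / c, ?_⟩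
    rintro _ ⟨w, rfl⟩
    rw [div_le_div_iff₀ (hpos w w.2.2) hc]
    calc |dEnergy f u w| * c ≤ (‖grad u‖ + ‖N (fn u)‖) * ‖(w : H10 Ω)‖ * c := by
          gcongr
          exact abs_dEnergy_le hN u w
      _ = (‖grad u‖ + ‖N (fn u)‖) * (c * ‖(w : H10 Ω)‖) := by ring
      _ ≤ _ := by
          gcongr
          exact hcn w

/-! ### Convergence of the algorithm -/

/-- On the final iterates, `E'` restricted to the Galerkin spaces tends to zero. -/
theorem exists_tendsto_zero_abs_dEnergy_le {f : Eu d → ℝ → ℝ} {ρ dt α : ℝ} (hΩ : MeasurableSet Ω)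
    (hf : NonlinearityAssumption Ω f ρ) (hdt : dt ∈ Lam Ω f ρ) (hα : 0 < α)
    {V : ℕ → Submodule ℝ (H10 Ω)} {u : ℕ → ℕ → H10 Ω} {nstar : ℕ → ℕ}
    (hrun : IsRun f dt α V u nstar) {M : ℝ} (hM : ∀ N, ‖u N (nstar N)‖ ≤ M) :
    ∃ δ : ℕ → ℝ, Tendsto δ atTop (𝓝 0) ∧
      ∀ N, ∀ v ∈ V N, |dEnergy f (u N (nstar N)) v| ≤ δ N * ‖v‖ := by
  have hcrit : ∀ N, StopCriterion f dt α (V N) (u N) (nstar N) := fun N => (hrun.least N).1.2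
  choose R hR hRle using hcrit
  -- By the restart rule `e (N + 1)` is also the final energy on level `N`.
  set e : ℕ → ℝ := fun N => energy f (u N 0) with he
  have hRe : ∀ N, lamNorm dt (R N) ≤ α * (e N - e (N + 1)) := by
    intro N
    rw [he]
    simp only [hrun.restart]
    exact hRle N
  have hanti : Antitone e := antitone_nat_of_succ_le fun N => by
    have h := (Real.sqrt_nonneg _).trans (hRe N)
    linarith [nonneg_of_mul_nonneg_right h hα]
  obtain ⟨C, hC⟩ := exists_le_energy hΩ hf hdt M
  have hbdd : BddBelow (range e) := by
    refine ⟨C, ?_⟩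
    rintro _ ⟨N, rfl⟩
    -- The bound `C` applies to final iterates, that is to `e (N + 1)`; monotonicity carries it back
    -- to `e N`.
    refine le_trans ?_ (hanti N.le_succ)
    rw [he]
    simp only [Nat.succ_eq_add_one, hrun.restart]
    exact hC _ (hM N)
  have hlim := tendsto_atTop_ciInf hanti hbdd
  have hdiff : Tendsto (fun N => e N - e (N + 1)) atTop (𝓝 0) := by
    simpa using hlim.sub (hlim.comp (tendsto_add_atTop_nat 1))
  obtain ⟨c, hc, hcn⟩ := exists_mul_norm_le_lamNorm (Ω := Ω) hdt.1
  refine ⟨fun N => (dt + 1) * (α * (e N - e (N + 1)) / c), ?_, fun N v hv => ?_⟩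
  · simpa using ((hdiff.const_mul α).div_const c).const_mul (dt + 1)
  · rw [← (hR N).2 v hv]
    refine (abs_bil_le hdt.1 _ _).trans ?_
    have := hdt.1
    refine mul_le_mul_of_nonneg_right ?_ (norm_nonneg v)
    refine mul_le_mul_of_nonneg_left ?_ (by positivity)
    rw [le_div_iff₀ hc, mul_comm]
    exact (hcn _).trans (hRe N)

end ILG
end

/-! ### Proof of the convergence theorem -/

open ILG in
theorem mainTheorem1 {d : ℕ} (Ω : Set (ILG.Eu d)) (hΩo : IsOpen Ω) (hΩb : Bornology.IsBounded Ω)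
    (f : ILG.Eu d → ℝ → ℝ) (ρ : ℝ) (hf : ILG.NonlinearityAssumption Ω f ρ)
    (CP : ℝ) (hCP : ILG.IsPoincareConst Ω CP)
    (dt : ℝ) (hdt : dt ∈ ILG.Lam Ω f ρ) (hdtκ : ILG.kappaf Ω f ρ CP < 1 / dt)
    (α : ℝ) (hα : α ∈ Set.Ioo (0 : ℝ) 1)
    (V : ℕ → Submodule ℝ (ILG.H10 Ω)) (hVfin : ∀ N, FiniteDimensional ℝ (V N))
    (hVmono : Monotone V)
    (u : ℕ → ℕ → ILG.H10 Ω) (nstar : ℕ → ℕ) (hrun : ILG.IsRun f dt α V u nstar)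
    (hbelow : ∀ N, BddBelow (Set.range fun n => ILG.energy f (u N n)))
    (q : ℝ) (hq : q ∈ Set.Ioo (0 : ℝ) 1)
    (hcontr : ∀ N, ILG.disPart f dt (V (N + 1)) (u N (nstar N))
      ≤ q * ILG.disPart f dt (V N) (u N (nstar N)))
    (hbdd : ∃ M : ℝ, ∀ N, ‖u N (nstar N)‖ ≤ M) :
    ∃ (φ : ℕ → ℕ) (ustar : ILG.H10 Ω), StrictMono φ ∧
      (∀ ℓ : ILG.H10 Ω →L[ℝ] ℝ,
        Tendsto (fun j => ℓ (u (φ j) (nstar (φ j)))) atTop (𝓝 (ℓ ustar))) ∧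
      Tendsto (fun j => ILG.fn (u (φ j) (nstar (φ j)))) atTop (𝓝 (ILG.fn ustar)) ∧
      ILG.IsWeakSolution f ustar ∧
      (ContinuousOn (fun p : ILG.Eu d × ℝ => f p.1 p.2) (closure Ω ×ˢ Set.univ) →
        ∃ ψ : ℕ → ℕ, StrictMono ψ ∧
          Tendsto (fun j => u (φ (ψ j)) (nstar (φ (ψ j)))) atTop (𝓝 ustar)) := by
  obtain ⟨M, hM⟩ := hbdd
  obtain ⟨N, L, hN, hL⟩ := exists_superposition hΩo.measurableSet hf hdt
  obtain ⟨δ, hδ, hδV⟩ :=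
    exists_tendsto_zero_abs_dEnergy_le hΩo.measurableSet hf hdt hα.1 hrun hM
  obtain ⟨φ, y, hφ, hweak⟩ := exists_subseq_weakly_tendsto hM
  have hfn := tendsto_fn_of_weakly_tendsto hΩb (fun j => hM (φ j)) hweak
  have hmem : ∀ n, u n (nstar n) ∈ V n := by
    intro n
    -- At least one step is made on each level, so the final iterate is the output of a step on `V
    -- n`.
    obtain ⟨k, hk⟩ := Nat.exists_eq_add_of_le' (hrun.least n).1.1
    rw [hk]
    exact (hrun.step n k).1
  set w : ℕ → H10 Ω := fun j => u (φ j) (nstar (φ j)) with hw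
  have hδφ : Tendsto (fun j => δ (φ j)) atTop (𝓝 0) := hδ.comp hφ.tendsto_atTop
  have hNw : Tendsto (fun j => N (fn (w j))) atTop (𝓝 (N (fn y))) :=
    (hL.continuous.tendsto _).comp hfn
  have hgradw : ∀ g : L2Vec Ω,
      Tendsto (fun j => inner ℝ g (grad (w j))) atTop (𝓝 (inner ℝ g (grad y))) := fun g =>
    hweak ((innerSL ℝ g).comp (gradL Ω))
  -- `E'(w j)` converges to `E'(y)` pointwise
  have hE : ∀ v, Tendsto (fun j => dEnergy f (w j) v) atTop (𝓝 (dEnergy f y v)) := by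
    intro v
    simp only [dEnergy_eq hN]
    refine Tendsto.sub ?_ (hNw.inner tendsto_const_nhds)
    simpa only [real_inner_comm] using hgradw (grad v)
  have hyV : ∀ n, ∀ v ∈ V n, dEnergy f y v = 0 := by
    intro n v hv
    refine tendsto_nhds_unique (hE v) (squeeze_zero_norm' ?_ (by simpa using hδφ.mul_const ‖v‖))
    filter_upwards [eventually_ge_atTop n] with j hj
    exact hδV (φ j) v (hVmono (hj.trans hφ.le_apply) hv)
  -- `E'(y)` is weakly continuous and vanishes on every `w j`.
  have hyy : dEnergy f y y = 0 := by
    obtain ⟨ℓ, hℓ⟩ := exists_clm_eq_dEnergy hN y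
    have h := hweak ℓ
    simp only [hℓ] at h
    refine tendsto_nhds_unique h ?_
    simp only [hyV _ _ (hmem _)]
    exact tendsto_const_nhds
  have hww : Tendsto (fun j => dEnergy f (w j) (w j)) atTop (𝓝 0) := by
    have h0 : Tendsto (fun j => |δ (φ j)| * M) atTop (𝓝 0) := by
      simpa using hδφ.abs.mul_const M
    refine squeeze_zero_norm (fun j => ?_) h0
    refine (hδV (φ j) _ (hmem _)).trans ?_
    exact mul_le_mul (le_abs_self _) (hM _) (norm_nonneg _) (abs_nonneg _)
  -- `‖∇w‖² = ⟨E'(w), w⟩ + ∫ f(x, w) w`, and both terms on the right converge.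
  have hgradn : Tendsto (fun j => ‖grad (w j)‖ ^ 2) atTop (𝓝 (‖grad y‖ ^ 2)) := by
    have h := hww.add (hNw.inner (𝕜 := ℝ) hfn)
    have e : ‖grad y‖ ^ 2 = 0 + inner ℝ (N (fn y)) (fn y) := by
      rw [← hyy, dEnergy_eq hN, real_inner_self_eq_norm_sq]
      ring
    rw [e]
    refine h.congr fun j => ?_
    rw [dEnergy_eq hN, real_inner_self_eq_norm_sq]
    ring
  have hstrong : Tendsto w atTop (𝓝 y) := by
    refine tendsto_of_inner_of_norm_sq ?_ ?_
    · simpa using hweak (innerSL ℝ y)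
    · simp only [norm_sq_eq]
      exact (hfn.norm.pow 2).add hgradn
  refine ⟨φ, y, hφ, hweak, hfn, fun v => ?_, fun _ => ⟨id, strictMono_id, hstrong⟩⟩
  obtain ⟨c, hc, hcn⟩ := exists_mul_norm_le_lamNorm (Ω := Ω) hdt.1
  have hdual : ∀ j, dualNorm f dt ⊤ (w j) ≤ (1 + L) * ‖w j - y‖ / c / (1 - q) := by
    intro j
    have h1 : dualNorm f dt (V (φ j + 1)) (w j) ≤ (1 + L) * ‖w j - y‖ / c := by
      refine dualNorm_le (by positivity) fun v hv => ?_
      have h2 := abs_dEnergy_sub_le hN hL (w j) y v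
      rw [hyV _ v hv, sub_zero] at h2
      refine h2.trans ?_
      rw [div_mul_eq_mul_div, le_div_iff₀ hc, mul_assoc]
      gcongr
      rw [mul_comm]
      exact hcn v
    -- Dropping the nonnegative term `q ‖E'(w_j)‖` on `V (φ j)` leaves `(1 - q) ‖E'(w_j)‖_{V'}`
    -- bounded by the dual norm on `V (φ j + 1)`.
    have h3 := hcontr (φ j)
    rw [disPart, disPart] at h3
    have h4 := mul_nonneg hq.1.le (dualNorm_nonneg f dt (V (φ j)) (w j))
    rw [le_div_iff₀ (by linarith [hq.2])]
    simp only [hw] at h1 h4 ⊢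
    nlinarith
  have hlim : Tendsto (fun j => (1 + L) * ‖w j - y‖ / c / (1 - q) * lamNorm dt v) atTop (𝓝 0) := by
    have h := (tendsto_iff_norm_sub_tendsto_zero.1 hstrong).const_mul (1 + (L : ℝ))
    simpa using ((h.div_const c).div_const (1 - q)).mul_const (lamNorm dt v)
  refine tendsto_nhds_unique (hE v) (squeeze_zero_norm (fun j => ?_) hlim)
  refine (abs_dEnergy_le_dualNorm hN hdt.1 (w j) v).trans ?_
  exact mul_le_mul_of_nonneg_right (hdual j) (Real.sqrt_nonneg _)
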